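/- Let $E=(E^0,E^1,r,s)$ be an arbitrary directed graph (arbitrary sets of vertices $E^0$ and edges $E^1$ with maps $r,s:E^1\to E^0$) and let $K$ be a field. Let $L=L_K(E)$ be the Leavitt path algebra, that is, the (not necessarily unital) $K$-algebra generated by a set $\{v : v\in E^0\}$ of pairwise orthogonal idempotents together with a set $\{e,e^*: e\in E^1\}$, subject to the relations (1) $s(e)e=e=e\,r(e)$ for all $e\in E^1$; (2) $r(e)e^*=e^*=e^*s(e)$ for all $e\in E^1$; (3) $e^*e=r(e)$ for all $e\in E^1$, and $e^*f=0$ for all $e\neq f$ in $E^1$; (4) $v=\sum_{e\in E^1,\ s(e)=v} ee^*$ for every $v\in E^0$ such that $s^{-1}(v)$ is finite and non-empty. Let $A=\mathrm{End}(L_L)$ be the unital ring of all endomorphisms of $L$ as a right $L$-module, i.e. of all additive maps $f:L\to L$ with $f(xy)=f(x)y$ for all $x,y\in L$, with multiplication given by composition. Then the Jacobson radical of $A$ is zero: $J(A)=0$. -/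

import Mathlib

universe u v w

/-- A directed graph `E = (E⁰, E¹, r, s)`: arbitrary sets of vertices and edges, with range and
source maps. Loops and parallel edges are allowed; there is no finiteness or countability
assumption. -/
structure DirectedGraph where
  /-- The vertices `E⁰`. -/
  Vertex : Type u
  /-- The edges `E¹`. -/
  Edge : Type v
  /-- The range map `r`. -/
  range : Edge → Vertex
  /-- The source map `s`. -/
  source : Edge → Vertex

namespace DirectedGraph

/-- The set `s⁻¹(v)` of edges emitted by `v`. -/
def emitted (E : DirectedGraph.{u, v}) (x : E.Vertex) : Set E.Edge :=
  {e | E.source e = x}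

/-- The generators of the Leavitt path algebra: the vertices `v`, the edges `e` and the
ghost edges `e*`. -/
inductive Gen (E : DirectedGraph.{u, v}) : Type (max u v)
  | vertex : E.Vertex → Gen E
  | edge : E.Edge → Gen E
  | ghost : E.Edge → Gen E

/-- The vertex `x`, as an element of the free algebra on the generators. -/
def freeVertex (K : Type w) [Field K] (E : DirectedGraph.{u, v}) (x : E.Vertex) :
    FreeAlgebra K E.Gen :=
  FreeAlgebra.ι K (Gen.vertex x)

/-- The edge `e`, as an element of the free algebra on the generators. -/
def freeEdge (K : Type w) [Field K] (E : DirectedGraph.{u, v}) (e : E.Edge) :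
    FreeAlgebra K E.Gen :=
  FreeAlgebra.ι K (Gen.edge e)

/-- The ghost edge `e*`, as an element of the free algebra on the generators. -/
def freeGhost (K : Type w) [Field K] (E : DirectedGraph.{u, v}) (e : E.Edge) :
    FreeAlgebra K E.Gen :=
  FreeAlgebra.ι K (Gen.ghost e)

/-- The defining relations of the Leavitt path algebra of `E`. -/
inductive LeavittRel (K : Type w) [Field K] (E : DirectedGraph.{u, v}) :
    FreeAlgebra K E.Gen → FreeAlgebra K E.Gen → Prop
  /-- Vertices are idempotent. -/
  | vertex_idem (x : E.Vertex) :
      LeavittRel K E (freeVertex K E x * freeVertex K E x) (freeVertex K E x)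
  /-- Distinct vertices are orthogonal. -/
  | vertex_orth (x y : E.Vertex) (h : x ≠ y) :
      LeavittRel K E (freeVertex K E x * freeVertex K E y) 0
  /-- `s(e) e = e`. -/
  | source_edge (e : E.Edge) :
      LeavittRel K E (freeVertex K E (E.source e) * freeEdge K E e) (freeEdge K E e)
  /-- `e r(e) = e`. -/
  | edge_range (e : E.Edge) :
      LeavittRel K E (freeEdge K E e * freeVertex K E (E.range e)) (freeEdge K E e)
  /-- `r(e) e* = e*`. -/
  | range_ghost (e : E.Edge) :
      LeavittRel K E (freeVertex K E (E.range e) * freeGhost K E e) (freeGhost K E e)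
  /-- `e* s(e) = e*`. -/
  | ghost_source (e : E.Edge) :
      LeavittRel K E (freeGhost K E e * freeVertex K E (E.source e)) (freeGhost K E e)
  /-- (CK-1) `e* e = r(e)`. -/
  | ck1_self (e : E.Edge) :
      LeavittRel K E (freeGhost K E e * freeEdge K E e) (freeVertex K E (E.range e))
  /-- (CK-1) `e* f = 0` for distinct edges `e`, `f`. -/
  | ck1_ne (e f : E.Edge) (h : e ≠ f) :
      LeavittRel K E (freeGhost K E e * freeEdge K E f) 0
  /-- (CK-2) `v = ∑ e e*`, over the edges `e` with `s(e) = v`, for every regular vertex `v`, that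
  is, every vertex which emits at least one and only finitely many edges. -/
  | ck2 (x : E.Vertex) (hne : (E.emitted x).Nonempty) (hfin : (E.emitted x).Finite) :
      LeavittRel K E (freeVertex K E x)
        (∑ e ∈ hfin.toFinset, freeEdge K E e * freeGhost K E e)

/-- The unital `K`-algebra presented by the generators and relations of the Leavitt path algebra.
Its identity is a formally adjoined one: it is the unitization of the Leavitt path algebra. -/
abbrev UnitalLeavitt (K : Type w) [Field K] (E : DirectedGraph.{u, v}) : Type (max u v w) :=
  RingQuot (LeavittRel K E)

/-- The class of a generator. -/
noncomputable def leavittGen (K : Type w) [Field K] (E : DirectedGraph.{u, v}) (g : E.Gen) :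
    UnitalLeavitt K E :=
  RingQuot.mkAlgHom K (LeavittRel K E) (FreeAlgebra.ι K g)

end DirectedGraph

/-- The Leavitt path algebra `L_K(E)`: the (not necessarily unital) `K`-algebra generated by the
vertices, edges and ghost edges of `E` subject to the Leavitt relations. It consists of the
`K`-linear combinations of nonempty products of generators; no identity element is adjoined, and
if `E` has finitely many vertices then its identity is the sum of the vertices. -/
noncomputable def LeavittPathAlgebra (K : Type w) [Field K] (E : DirectedGraph.{u, v}) :
    NonUnitalSubalgebra K (DirectedGraph.UnitalLeavitt K E) :=
  NonUnitalAlgebra.adjoin K (Set.range (DirectedGraph.leavittGen K E))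

/-- The endomorphism ring `End(R_R)` of a (not necessarily unital) ring `R` regarded as a right
module over itself: the additive maps `f : R → R` with `f (x y) = f(x) y`, under pointwise addition
and composition `(f g)(x) = f(g(x))`, with the identity map as identity element. -/
def rightModuleEnd (R : Type u) [NonUnitalRing R] : Subring (AddMonoid.End R) where
  carrier := {f | ∀ x y : R, f (x * y) = f x * y}
  mul_mem' := fun {f g} hf hg x y => (congrArg f (hg x y)).trans (hf (g x) y)
  one_mem' := fun _ _ => rfl
  add_mem' := fun {f g} hf hg x y =>
    (congrArg₂ (· + ·) (hf x y) (hg x y)).trans (add_mul (f x) (g x) y).symm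
  zero_mem' := fun _ y => (zero_mul y).symm
  neg_mem' := fun {f} hf x y => (congrArg Neg.neg (hf x y)).trans (neg_mul (f x) y).symm

/-! Let `f` be a nonzero element of the radical and `b = f(a) ≠ 0`. Write `λ_c` for left
multiplication by `c`. Right linearity gives `f ∘ λ_a = λ_b`, so `λ_z` lies in the radical for every
`z = s b t` with `s`, `t` in `L`. It therefore has a right quasi-inverse, of the form `g ∘ λ_z =
λ_y` with `y = g(z)` in `L`. Since `L` has local units, the resulting operator identity becomes `(1
- z)(1 + y) = 1` in the unitization. It remains to choose `s` and `t` so that `1 - s b t` has no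
right inverse there (`exists_one_sub_mul_mul_ne_one`).

Multiplying `b` on the right by edges removes ghost edges until a nonzero combination of paths
ending at one vertex `x` is left (`exists_mul_mem_pathSpan`). Multiplying on the left by the ghost
of a shortest path turns it into `x + q`, where `q` is a combination of nontrivial closed paths at
`x` (`exists_mul_eq_add_of_mem_pathSpan`).

If there is no such closed path, then `q = 0`, and `1 - x` is annihilated by the nonzero idempotent
`x`. Otherwise multiply by one closed path `l`: a right inverse of `1 - l(x + q)` would have to
behave like an infinite geometric series of growing degree. This is excluded by a representation on
functions on a graded set of points, in which algebra elements preserve boundedness of degree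
(`one_sub_mul_ne_one`). The same representation shows that the path combinations in question do not
vanish. -/

namespace DirectedGraph

/-! ### Existence of graded branching systems -/

/-- A graded branching system of `E`: a set of points, each lying over a vertex, such that every
edge `e` induces a bijection `enc e` of the points over `r(e)` onto a set of points over `s(e)`;
these sets are disjoint, they cover the points over a vertex that emits an edge, and `enc e` raises
the degree by one. The partial inverse of the maps `enc e` is `dec`. -/
structure GradedBranching (E : DirectedGraph.{u, v}) where
  /-- The points. -/
  Point : Type (max u v)
  /-- The vertex below a point. -/
  src : Point → E.Vertex
  /-- The degree of a point. -/
  deg : Point → ℤ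
  /-- The first edge and the remaining point, if there is one. -/
  dec : Point → Option (E.Edge × Point)
  /-- The action of an edge. -/
  enc : E.Edge → Point → Point
  src_enc : ∀ e x, src (enc e x) = E.source e
  deg_enc : ∀ e x, deg (enc e x) = deg x + 1
  dec_enc : ∀ e x, src x = E.range e → dec (enc e x) = some (e, x)
  src_of_dec : ∀ {z e x}, dec z = some (e, x) → src x = E.range e
  enc_of_dec : ∀ {z e x}, dec z = some (e, x) → enc e x = z
  source_ne_of_dec : ∀ {z} e, dec z = none → E.source e ≠ src z
  exists_src : ∀ y, ∃ x, src x = y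

/-- Cardinal absorption: the summand `ℕ` makes the set infinite, and the summand `E.Edge` makes it
at least as large as any set of emitted edges. -/
theorem nonempty_equiv_emitted_prod (E : DirectedGraph.{u, v}) (x : E.Vertex)
    (h : (E.emitted x).Nonempty) :
    Nonempty ((E.Edge ⊕ ℕ) ≃ E.emitted x × (E.Edge ⊕ ℕ)) := by
  have : Nonempty (E.emitted x) := h.to_subtype
  rw [← Cardinal.eq, Cardinal.mk_prod, Cardinal.lift_id, Cardinal.lift_id, Cardinal.mul_eq_right]
  · exact Cardinal.aleph0_le_mk _
  · exact Cardinal.mk_le_of_injective (f := fun e => Sum.inl e.1)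
      fun a b hab => Subtype.ext (Sum.inl_injective hab)
  · exact Cardinal.mk_ne_zero _

-- All vertices get the same infinite fibre, which the previous bijection splits among the emitted
-- edges. The separate factor `ℤ` leaves the degree free to be shifted by one along each edge.
open Classical in
theorem nonempty_gradedBranching (E : DirectedGraph.{u, v}) : Nonempty (GradedBranching E) := by
  let f := fun x h => (E.nonempty_equiv_emitted_prod x h).some
  exact ⟨{
    Point := E.Vertex × (E.Edge ⊕ ℕ) × ℤ
    src := fun x => x.1
    deg := fun x => x.2.2
    dec := fun x => if h : (E.emitted x.1).Nonempty then
        some ((f x.1 h x.2.1).1.1,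
          (E.range (f x.1 h x.2.1).1.1, (f x.1 h x.2.1).2, x.2.2 - 1))
      else none
    enc := fun e x => (E.source e, (f (E.source e) ⟨e, rfl⟩).symm (⟨e, rfl⟩, x.2.1), x.2.2 + 1)
    src_enc := fun _ _ => rfl
    deg_enc := fun _ _ => rfl
    dec_enc := by
      rintro e ⟨y, a, n⟩ h
      have hne : (E.emitted (E.source e)).Nonempty := ⟨e, rfl⟩
      simp only at h
      simp [hne, h]
    src_of_dec := by
      rintro ⟨y, a, n⟩ e x h
      simp only at h
      split_ifs at h with hne
      simp only [Option.some.injEq, Prod.mk.injEq] at h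
      rw [← h.2, ← h.1]
    enc_of_dec := by
      rintro ⟨y, a, n⟩ e x h
      simp only at h
      split_ifs at h with hne
      simp only [Option.some.injEq, Prod.mk.injEq] at h
      obtain ⟨rfl, rfl⟩ := h
      have hs : E.source (f y hne a).1.1 = y := (f y hne a).1.2
      -- The source of the decoded edge equals `y` only propositionally, while `f` depends on the
      -- vertex; a variable `y'` makes substitution possible.
      have key : ∀ (y' : E.Vertex) (hy : y' = y) (h1 : (E.emitted y').Nonempty)
          (h2 : (f y hne a).1.1 ∈ E.emitted y'),
          (f y' h1).symm (⟨(f y hne a).1.1, h2⟩, (f y hne a).2) = a := by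
        rintro y' rfl h1 h2
        simp
      exact Prod.ext hs (Prod.ext (key _ hs ⟨_, rfl⟩ rfl) (sub_add_cancel n 1))
    source_ne_of_dec := by
      rintro ⟨y, a, n⟩ e h hs
      simp only at h
      split_ifs at h with hne
      exact hne ⟨e, hs⟩
    exists_src := fun y => ⟨(y, Sum.inr 0, 0), rfl⟩ }⟩

/-! ### The representation on functions on the points -/

namespace GradedBranching

variable {E : DirectedGraph.{u, v}} (X : GradedBranching E) (K : Type w) [Field K]

open Classical in
/-- The operator of a generator on the functions on the points. -/
noncomputable def genOp : E.Gen → Module.End K (X.Point → K)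
  | .vertex y =>
    { toFun := fun m z => if X.src z = y then m z else 0
      map_add' := fun m m' => by ext z; by_cases h : X.src z = y <;> simp [h]
      map_smul' := fun k m => by ext z; by_cases h : X.src z = y <;> simp [h] }
  | .edge e =>
    { toFun := fun m z => (X.dec z).elim 0 fun p => if p.1 = e then m p.2 else 0
      map_add' := fun m m' => by
        ext z
        rcases h : X.dec z with _ | ⟨f, x⟩
        · simp [h]
        · by_cases hf : f = e <;> simp [h, hf]
      map_smul' := fun k m => by
        ext z
        rcases h : X.dec z with _ | ⟨f, x⟩
        · simp [h]
        · by_cases hf : f = e <;> simp [h, hf] }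
  | .ghost e =>
    { toFun := fun m z => if X.src z = E.range e then m (X.enc e z) else 0
      map_add' := fun m m' => by ext z; by_cases h : X.src z = E.range e <;> simp [h]
      map_smul' := fun k m => by ext z; by_cases h : X.src z = E.range e <;> simp [h] }

open Classical in
theorem genOp_vertex (y : E.Vertex) (m : X.Point → K) (z : X.Point) :
    X.genOp K (.vertex y) m z = if X.src z = y then m z else 0 := rfl

open Classical in
theorem genOp_ghost (e : E.Edge) (m : X.Point → K) (z : X.Point) :
    X.genOp K (.ghost e) m z = if X.src z = E.range e then m (X.enc e z) else 0 := rfl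

open Classical in
theorem genOp_edge (e : E.Edge) (m : X.Point → K) (z : X.Point) :
    X.genOp K (.edge e) m z = (X.dec z).elim 0 fun p => if p.1 = e then m p.2 else 0 := rfl

theorem genOp_edge_ne_zero {e : E.Edge} {m : X.Point → K} {z : X.Point}
    (h : X.genOp K (.edge e) m z ≠ 0) :
    ∃ x, X.src x = E.range e ∧ z = X.enc e x ∧ m x ≠ 0 := by
  rw [genOp_edge] at h
  rcases hz : X.dec z with _ | ⟨f, x⟩
  · simp [hz] at h
  · by_cases hf : f = e
    · subst hf
      exact ⟨x, X.src_of_dec hz, (X.enc_of_dec hz).symm, by simpa [hz] using h⟩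
    · simp [hz, hf] at h

theorem genOp_edge_enc {e : E.Edge} (m : X.Point → K) {x : X.Point} (h : X.src x = E.range e) :
    X.genOp K (.edge e) m (X.enc e x) = m x := by
  simp [genOp_edge, X.dec_enc e x h]

theorem genOp_edge_enc_of_ne {e f : E.Edge} (hef : e ≠ f) (m : X.Point → K) {x : X.Point}
    (h : X.src x = E.range e) : X.genOp K (.edge f) m (X.enc e x) = 0 := by
  simp [genOp_edge, X.dec_enc e x h, hef]

/-- The partition of each fibre is what gives (CK-2): at a point with first edge `f` only the term
of `f` survives, and a point without first edge does not lie over an emitting vertex. -/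
theorem lift_genOp_rel {a b : FreeAlgebra K E.Gen} (h : LeavittRel K E a b) :
    FreeAlgebra.lift K (X.genOp K) a = FreeAlgebra.lift K (X.genOp K) b := by
  classical
  refine LinearMap.ext fun m => funext fun z => ?_
  cases h with
  | vertex_idem y =>
    simp only [freeVertex, map_mul, FreeAlgebra.lift_ι_apply, Module.End.mul_apply, genOp_vertex]
    split_ifs <;> rfl
  | vertex_orth x y hxy =>
    simp only [freeVertex, map_mul, FreeAlgebra.lift_ι_apply, Module.End.mul_apply, genOp_vertex,
      map_zero, LinearMap.zero_apply, Pi.zero_apply]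
    split_ifs with h1 h2
    · exact absurd (h1.symm.trans h2) hxy
    · rfl
    · rfl
  | source_edge e =>
    simp only [freeVertex, freeEdge, map_mul, FreeAlgebra.lift_ι_apply, Module.End.mul_apply,
      genOp_vertex]
    split_ifs with h1
    · rfl
    · by_contra h2
      obtain ⟨x, -, rfl, -⟩ := X.genOp_edge_ne_zero K (Ne.symm h2)
      exact h1 (X.src_enc e x)
  | edge_range e =>
    simp only [freeVertex, freeEdge, map_mul, FreeAlgebra.lift_ι_apply, Module.End.mul_apply,
      genOp_edge]
    rcases hz : X.dec z with _ | ⟨f, x⟩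
    · simp
    · by_cases hf : f = e
      · subst hf
        simp [genOp_vertex, X.src_of_dec hz]
      · simp [hf]
  | range_ghost e =>
    simp only [freeVertex, freeGhost, map_mul, FreeAlgebra.lift_ι_apply, Module.End.mul_apply,
      genOp_vertex, genOp_ghost]
    split_ifs <;> rfl
  | ghost_source e =>
    simp only [freeVertex, freeGhost, map_mul, FreeAlgebra.lift_ι_apply, Module.End.mul_apply,
      genOp_vertex, genOp_ghost, X.src_enc, if_true]
  | ck1_self e =>
    simp only [freeVertex, freeGhost, freeEdge, map_mul, FreeAlgebra.lift_ι_apply,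
      Module.End.mul_apply, genOp_vertex, genOp_ghost]
    split_ifs with h
    · exact X.genOp_edge_enc K m h
    · rfl
  | ck1_ne e f hef =>
    simp only [freeGhost, freeEdge, map_mul, FreeAlgebra.lift_ι_apply,
      Module.End.mul_apply, genOp_ghost, map_zero, LinearMap.zero_apply, Pi.zero_apply]
    split_ifs with h
    · exact X.genOp_edge_enc_of_ne K hef m h
    · rfl
  | ck2 y hne hfin =>
    simp only [freeVertex, freeGhost, freeEdge, map_mul, map_sum, FreeAlgebra.lift_ι_apply,
      LinearMap.sum_apply, Finset.sum_apply, Module.End.mul_apply, genOp_vertex]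
    rcases hz : X.dec z with _ | ⟨f, x⟩
    · obtain ⟨e, he⟩ := hne
      have hy : X.src z ≠ y := fun h => X.source_ne_of_dec e hz (he.trans h.symm)
      simp [genOp_edge, hz, hy]
    · have hx := X.src_of_dec hz
      have hzx := X.enc_of_dec hz
      have hs : X.src z = E.source f := by rw [← hzx, X.src_enc]
      have hterm : ∀ e, X.genOp K (.edge e) (X.genOp K (.ghost e) m) z =
          if f = e then m z else 0 := by
        intro e
        by_cases hf : f = e
        · subst hf
          simp [genOp_edge, hz, genOp_ghost, hx, hzx]
        · simp [genOp_edge, hz, hf]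
      simp only [hterm, Finset.sum_ite_eq, Set.Finite.mem_toFinset]
      have hiff : X.src z = y ↔ f ∈ E.emitted y := by rw [hs]; rfl
      simp only [hiff]

/-- The representation of the unitized Leavitt path algebra on the functions on the points. -/
noncomputable def rep : UnitalLeavitt K E →ₐ[K] Module.End K (X.Point → K) :=
  RingQuot.liftAlgHom K ⟨FreeAlgebra.lift K (X.genOp K), fun _ _ h => X.lift_genOp_rel K h⟩

theorem rep_gen (g : E.Gen) : X.rep K (leavittGen K E g) = X.genOp K g := by
  simp [rep, leavittGen]

/-- The functions whose support is bounded in degree. -/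
def IsBdd (m : X.Point → K) : Prop := ∃ N : ℤ, ∀ z, m z ≠ 0 → |X.deg z| ≤ N

variable {K}

theorem isBdd_add {m m' : X.Point → K} (h : X.IsBdd K m) (h' : X.IsBdd K m') :
    X.IsBdd K (m + m') := by
  obtain ⟨N, hN⟩ := h
  obtain ⟨N', hN'⟩ := h'
  refine ⟨max N N', fun z hz => ?_⟩
  by_cases hm : m z = 0
  · exact (hN' z fun h0 => hz (by simp [hm, h0])).trans (le_max_right _ _)
  · exact (hN z hm).trans (le_max_left _ _)

theorem isBdd_genOp (g : E.Gen) {m : X.Point → K} (h : X.IsBdd K m) :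
    X.IsBdd K (X.genOp K g m) := by
  obtain ⟨N, hN⟩ := h
  refine ⟨N + 1, fun z hz => ?_⟩
  cases g with
  | vertex y =>
    rw [genOp_vertex] at hz
    have := hN z fun h0 => hz (by simp [h0])
    omega
  | edge e =>
    obtain ⟨x, -, rfl, hx⟩ := X.genOp_edge_ne_zero K hz
    have := hN x hx
    rw [X.deg_enc]
    grind
  | ghost e =>
    rw [genOp_ghost] at hz
    have := hN (X.enc e z) fun h0 => hz (by simp [h0])
    rw [X.deg_enc] at this
    grind

/-- Each generator shifts degrees by at most one. This guarantees extreme degrees in the image of a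
point mass under a hypothetical inverse. -/
theorem isBdd_rep (a : UnitalLeavitt K E) {m : X.Point → K} (h : X.IsBdd K m) :
    X.IsBdd K (X.rep K a m) := by
  obtain ⟨a, rfl⟩ := RingQuot.mkAlgHom_surjective K (LeavittRel K E) a
  induction a using FreeAlgebra.induction generalizing m with
  | grade0 r =>
    obtain ⟨N, hN⟩ := h
    refine ⟨N, fun z hz => hN z fun h0 => hz ?_⟩
    simp [h0]
  | grade1 g => exact (X.rep_gen K g).symm ▸ X.isBdd_genOp g h
  | mul a b ha hb => rw [map_mul, map_mul]; exact ha (hb h)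
  | add a b ha hb => rw [map_add, map_add]; exact X.isBdd_add (ha h) (hb h)

end GradedBranching

end DirectedGraph

/-! ### Relations, paths and closed paths in the Leavitt path algebra -/

namespace DirectedGraph

variable (K : Type w) [Field K] {E : DirectedGraph.{u, v}}

/-- The vertex `x` in the Leavitt path algebra. -/
noncomputable abbrev vtx (x : E.Vertex) : UnitalLeavitt K E := leavittGen K E (.vertex x)

/-- The edge `e` in the Leavitt path algebra. -/
noncomputable abbrev edg (e : E.Edge) : UnitalLeavitt K E := leavittGen K E (.edge e)

/-- The ghost edge `e*` in the Leavitt path algebra. -/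
noncomputable abbrev gho (e : E.Edge) : UnitalLeavitt K E := leavittGen K E (.ghost e)

theorem mkAlgHom_eq_of_leavittRel {a b : FreeAlgebra K E.Gen} (h : LeavittRel K E a b) :
    RingQuot.mkAlgHom K (LeavittRel K E) a = RingQuot.mkAlgHom K (LeavittRel K E) b :=
  RingQuot.mkAlgHom_rel K h

theorem vtx_mul_self (x : E.Vertex) : vtx K x * vtx K x = vtx K x := by
  have h := mkAlgHom_eq_of_leavittRel K (.vertex_idem x)
  simp only [map_mul] at h
  exact h

theorem vtx_mul_vtx_of_ne {x y : E.Vertex} (h : x ≠ y) : vtx K x * vtx K y = 0 := by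
  have h' := mkAlgHom_eq_of_leavittRel K (.vertex_orth x y h)
  simp only [map_mul, map_zero] at h'
  exact h'

theorem source_mul_edg (e : E.Edge) : vtx K (E.source e) * edg K e = edg K e := by
  have h := mkAlgHom_eq_of_leavittRel K (.source_edge e)
  simp only [map_mul] at h
  exact h

theorem edg_mul_range (e : E.Edge) : edg K e * vtx K (E.range e) = edg K e := by
  have h := mkAlgHom_eq_of_leavittRel K (.edge_range e)
  simp only [map_mul] at h
  exact h

theorem range_mul_gho (e : E.Edge) : vtx K (E.range e) * gho K e = gho K e := by
  have h := mkAlgHom_eq_of_leavittRel K (.range_ghost e)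
  simp only [map_mul] at h
  exact h

theorem gho_mul_source (e : E.Edge) : gho K e * vtx K (E.source e) = gho K e := by
  have h := mkAlgHom_eq_of_leavittRel K (.ghost_source e)
  simp only [map_mul] at h
  exact h

theorem gho_mul_edg_self (e : E.Edge) : gho K e * edg K e = vtx K (E.range e) := by
  have h := mkAlgHom_eq_of_leavittRel K (.ck1_self e)
  simp only [map_mul] at h
  exact h

theorem gho_mul_edg_of_ne {e f : E.Edge} (h : e ≠ f) : gho K e * edg K f = 0 := by
  have h' := mkAlgHom_eq_of_leavittRel K (.ck1_ne e f h)
  simp only [map_mul, map_zero] at h'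
  exact h'

theorem vtx_eq_sum (x : E.Vertex) (hne : (E.emitted x).Nonempty) (hfin : (E.emitted x).Finite) :
    vtx K x = ∑ e ∈ hfin.toFinset, edg K e * gho K e := by
  have h := mkAlgHom_eq_of_leavittRel K (.ck2 x hne hfin)
  simp only [map_mul, map_sum] at h
  exact h

theorem vtx_mul_edg_of_ne {x : E.Vertex} {e : E.Edge} (h : x ≠ E.source e) :
    vtx K x * edg K e = 0 := by
  rw [← source_mul_edg, ← mul_assoc, vtx_mul_vtx_of_ne K h, zero_mul]

theorem gho_mul_vtx_of_ne {x : E.Vertex} {e : E.Edge} (h : E.source e ≠ x) :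
    gho K e * vtx K x = 0 := by
  rw [← gho_mul_source, mul_assoc, vtx_mul_vtx_of_ne K h, mul_zero]

theorem leavittGen_mem (g : E.Gen) : leavittGen K E g ∈ LeavittPathAlgebra K E :=
  NonUnitalAlgebra.subset_adjoin K ⟨g, rfl⟩

/-- `IsPath y l x` says that the list `l` of edges is a path from `y` to `x`. -/
def IsPath : E.Vertex → List E.Edge → E.Vertex → Prop
  | y, [], x => y = x
  | y, e :: l, x => E.source e = y ∧ IsPath (E.range e) l x

/-- The product of the vertex `y` and the edges of `l`. -/
noncomputable def pathElt (y : E.Vertex) : List E.Edge → UnitalLeavitt K E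
  | [] => vtx K y
  | e :: l => edg K e * pathElt (E.range e) l

/-- The product of the ghost edges of `l` in the opposite order and the vertex `y`. -/
noncomputable def ghostPathElt (y : E.Vertex) : List E.Edge → UnitalLeavitt K E
  | [] => vtx K y
  | e :: l => ghostPathElt (E.range e) l * gho K e

theorem vtx_mul_pathElt {y : E.Vertex} {l : List E.Edge} {x : E.Vertex} (h : IsPath y l x) :
    vtx K y * pathElt K y l = pathElt K y l := by
  cases l with
  | nil => exact vtx_mul_self K y
  | cons e l => rw [pathElt, ← mul_assoc, ← h.1, source_mul_edg]

theorem pathElt_mul_vtx {y : E.Vertex} {l : List E.Edge} {x : E.Vertex} (h : IsPath y l x) :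
    pathElt K y l * vtx K x = pathElt K y l := by
  induction l generalizing y with
  | nil => obtain rfl : y = x := h; exact vtx_mul_self K y
  | cons e l ih => rw [pathElt, mul_assoc, ih h.2]

theorem pathElt_mul_edg {y : E.Vertex} {l : List E.Edge} {e : E.Edge}
    (h : IsPath y l (E.source e)) : pathElt K y l * edg K e = pathElt K y (l ++ [e]) := by
  induction l generalizing y with
  | nil =>
    obtain rfl : y = E.source e := h
    simp only [List.nil_append, pathElt, source_mul_edg, edg_mul_range]
  | cons f l ih => rw [pathElt, mul_assoc, ih h.2]; rfl

theorem isPath_append_singleton {y : E.Vertex} {l : List E.Edge} {e : E.Edge}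
    (h : IsPath y l (E.source e)) : IsPath y (l ++ [e]) (E.range e) := by
  induction l generalizing y with
  | nil => exact ⟨Eq.symm h, rfl⟩
  | cons f l ih => exact ⟨h.1, ih h.2⟩

theorem ghostPathElt_mem (y : E.Vertex) (l : List E.Edge) :
    ghostPathElt K y l ∈ LeavittPathAlgebra K E := by
  induction l generalizing y with
  | nil => exact leavittGen_mem K _
  | cons e l ih => exact mul_mem (ih _) (leavittGen_mem K _)

theorem pathElt_mem (y : E.Vertex) (l : List E.Edge) :
    pathElt K y l ∈ LeavittPathAlgebra K E := by
  induction l generalizing y with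
  | nil => exact leavittGen_mem K _
  | cons e l ih => exact mul_mem (leavittGen_mem K _) (ih _)

theorem ghostPathElt_mul_pathElt_self {y : E.Vertex} {l : List E.Edge} {x : E.Vertex}
    (h : IsPath y l x) : ghostPathElt K y l * pathElt K y l = vtx K x := by
  induction l generalizing y with
  | nil => obtain rfl : y = x := h; exact vtx_mul_self K y
  | cons e l ih =>
    rw [ghostPathElt, pathElt, mul_assoc, ← mul_assoc (gho K e), gho_mul_edg_self,
      vtx_mul_pathElt K h.2, ih h.2]

/-- The span of the nontrivial closed paths at `x`. -/
noncomputable def closedSpan (x : E.Vertex) : Submodule K (UnitalLeavitt K E) :=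
  Submodule.span K (pathElt K x '' {l | IsPath x l x ∧ l ≠ []})

/-- By (CK-1) common initial edges cancel and a mismatch gives zero. If `l` is used up, the rest of
`l'` runs from `x` to `x`, and it is nontrivial because the two paths differ. -/
theorem ghostPathElt_mul_pathElt_mem {y y' : E.Vertex} {l l' : List E.Edge} {x : E.Vertex}
    (h : IsPath y l x) (h' : IsPath y' l' x) (hlen : l.length ≤ l'.length)
    (hne : (y, l) ≠ (y', l')) :
    ghostPathElt K y l * pathElt K y' l' ∈ closedSpan K x := by
  induction l generalizing y y' l' with
  | nil =>
    obtain rfl : y = x := h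
    by_cases hy : y = y'
    · subst hy
      rw [ghostPathElt, vtx_mul_pathElt K h']
      exact Submodule.subset_span ⟨l', ⟨h', fun h0 => hne (by rw [h0])⟩, rfl⟩
    · rw [ghostPathElt, ← vtx_mul_pathElt K h', ← mul_assoc, vtx_mul_vtx_of_ne K hy, zero_mul]
      exact zero_mem _
  | cons e l ih =>
    cases l' with
    | nil => simp at hlen
    | cons f l' =>
      rw [ghostPathElt, pathElt, mul_assoc, ← mul_assoc (gho K e)]
      by_cases hef : e = f
      · subst hef
        rw [gho_mul_edg_self, vtx_mul_pathElt K h'.2]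
        refine ih h.2 h'.2 (by simpa using hlen) fun h0 => hne ?_
        rw [← h.1, ← h'.1, (Prod.mk.inj h0).2]
      · rw [gho_mul_edg_of_ne K hef, zero_mul, mul_zero]
        exact zero_mem _

/-- The span of the paths that end in `x`. -/
noncomputable def pathSpan (x : E.Vertex) : Submodule K (UnitalLeavitt K E) :=
  Submodule.span K ((fun p : E.Vertex × List E.Edge => pathElt K p.1 p.2) ''
    {p | IsPath p.1 p.2 x})

theorem exists_sum_of_mem_pathSpan {x : E.Vertex} {b : UnitalLeavitt K E}
    (hb : b ∈ pathSpan K x) :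
    ∃ c : (E.Vertex × List E.Edge) →₀ K, (∀ p ∈ c.support, IsPath p.1 p.2 x) ∧
      b = ∑ p ∈ c.support, c p • pathElt K p.1 p.2 := by
  obtain ⟨c, hc, rfl⟩ := (Finsupp.mem_span_image_iff_linearCombination K).1 hb
  exact ⟨c, fun p hp => hc hp, rfl⟩

theorem mul_vtx_of_mem_pathSpan {x : E.Vertex} {b : UnitalLeavitt K E} (hb : b ∈ pathSpan K x) :
    b * vtx K x = b := by
  induction hb using Submodule.span_induction with
  | mem b hb => obtain ⟨p, hp, rfl⟩ := hb; exact pathElt_mul_vtx K hp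
  | zero => exact zero_mul _
  | add a b _ _ ha hb => rw [add_mul, ha, hb]
  | smul k a _ ha => rw [smul_mul_assoc, ha]

/-- The factor `s` is the ghost of a shortest path in the support, divided by its coefficient.
Minimality of the length makes every other term fall into the closed span. -/
theorem exists_mul_eq_add_of_mem_pathSpan {x : E.Vertex} {b : UnitalLeavitt K E}
    (hb : b ∈ pathSpan K x) (h0 : b ≠ 0) :
    ∃ s ∈ LeavittPathAlgebra K E, ∃ q ∈ closedSpan K x, s * b = vtx K x + q := by
  classical
  obtain ⟨c, hc, rfl⟩ := exists_sum_of_mem_pathSpan K hb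
  have hne : c.support.Nonempty := by
    rw [Finset.nonempty_iff_ne_empty]
    intro h
    simp [h] at h0
  obtain ⟨p, hp, hmin⟩ := c.support.exists_min_image (fun p => p.2.length) hne
  have hcp : c p ≠ 0 := Finsupp.mem_support_iff.1 hp
  refine ⟨(c p)⁻¹ • ghostPathElt K p.1 p.2, SMulMemClass.smul_mem _ (ghostPathElt_mem K _ _),
    ∑ p' ∈ c.support.erase p,
      (c p)⁻¹ • (c p' • (ghostPathElt K p.1 p.2 * pathElt K p'.1 p'.2)),
    Submodule.sum_mem _ fun p' hp' => Submodule.smul_mem _ _ (Submodule.smul_mem _ _ ?_), ?_⟩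
  · rw [Finset.mem_erase] at hp'
    exact ghostPathElt_mul_pathElt_mem K (hc p hp) (hc p' hp'.2) (hmin p' hp'.2) hp'.1.symm
  · rw [Finset.mul_sum, ← Finset.add_sum_erase _ _ hp]
    congr 1
    · rw [smul_mul_smul_comm, inv_mul_cancel₀ hcp, one_smul,
        ghostPathElt_mul_pathElt_self K (hc p hp)]
    · exact Finset.sum_congr rfl fun p' _ => by rw [smul_mul_assoc, mul_smul_comm]

end DirectedGraph

/-! ### Degree arguments and elements that are not right invertible -/

namespace DirectedGraph

namespace GradedBranching

variable {E : DirectedGraph.{u, v}} (X : GradedBranching E) {K : Type w} [Field K]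

/-- The action of the edges of a list on the points. -/
def encPath (x : X.Point) : List E.Edge → X.Point
  | [] => x
  | e :: l => X.enc e (encPath x l)

theorem src_encPath {x : X.Point} {y : E.Vertex} {l : List E.Edge} (h : IsPath y l (X.src x)) :
    X.src (X.encPath x l) = y := by
  cases l with
  | nil => exact Eq.symm h
  | cons e l => exact (X.src_enc e _).trans h.1

theorem deg_encPath (x : X.Point) (l : List E.Edge) :
    X.deg (X.encPath x l) = X.deg x + l.length := by
  induction l with
  | nil => simp [encPath]
  | cons e l ih => rw [encPath, X.deg_enc, ih]; push_cast [List.length_cons]; ring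

open Classical in
theorem rep_vtx (y : E.Vertex) (m : X.Point → K) (z : X.Point) :
    X.rep K (vtx K y) m z = if X.src z = y then m z else 0 := by
  rw [rep_gen, genOp_vertex]

theorem rep_pathElt_ne_zero {y x : E.Vertex} {l : List E.Edge} (h : IsPath y l x)
    {m : X.Point → K} {z : X.Point} (hz : X.rep K (pathElt K y l) m z ≠ 0) :
    ∃ t, X.src t = x ∧ z = X.encPath t l ∧ m t ≠ 0 := by
  classical
  induction l generalizing y z with
  | nil =>
    obtain rfl : y = x := h
    rw [pathElt, rep_vtx, ite_ne_right_iff] at hz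
    exact ⟨z, hz.1, rfl, hz.2⟩
  | cons e l ih =>
    rw [pathElt, map_mul, Module.End.mul_apply, rep_gen] at hz
    obtain ⟨z', -, rfl, hz'⟩ := X.genOp_edge_ne_zero K hz
    obtain ⟨t, ht, rfl, hm⟩ := ih h.2 hz'
    exact ⟨t, ht, rfl, hm⟩

theorem rep_pathElt_encPath {y : E.Vertex} {l : List E.Edge} {t : X.Point}
    (h : IsPath y l (X.src t)) (m : X.Point → K) :
    X.rep K (pathElt K y l) m (X.encPath t l) = m t := by
  classical
  induction l generalizing y with
  | nil =>
    rw [pathElt, encPath, rep_vtx, if_pos (Eq.symm h)]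
  | cons e l ih =>
    rw [pathElt, map_mul, Module.End.mul_apply, rep_gen, encPath,
      X.genOp_edge_enc K _ (X.src_encPath h.2), ih h.2]

theorem encPath_inj {y y' : E.Vertex} {l l' : List E.Edge} {t t' : X.Point}
    (h : IsPath y l (X.src t)) (h' : IsPath y' l' (X.src t')) (hlen : l.length = l'.length)
    (heq : X.encPath t l = X.encPath t' l') : (y, l) = (y', l') ∧ t = t' := by
  induction l generalizing y y' l' with
  | nil =>
    obtain rfl : l' = [] := List.length_eq_zero_iff.1 hlen.symm
    obtain rfl : t = t' := heq
    obtain rfl : y = X.src t := h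
    obtain rfl : y' = X.src t := h'
    exact ⟨rfl, rfl⟩
  | cons e l ih =>
    cases l' with
    | nil => simp at hlen
    | cons f l' =>
      have h1 := X.dec_enc e _ (X.src_encPath h.2)
      have h2 := X.dec_enc f _ (X.src_encPath h'.2)
      rw [encPath, encPath] at heq
      rw [heq, h2, Option.some.injEq, Prod.mk.injEq] at h1
      obtain ⟨rfl, h1⟩ := h1
      obtain ⟨h3, h4⟩ := ih h.2 h'.2 (by simpa using hlen) h1.symm
      exact ⟨by rw [← h.1, ← h'.1, (Prod.mk.inj h3).2], h4⟩

theorem rep_sum_smul (s : Finset (E.Vertex × List E.Edge)) (c : E.Vertex × List E.Edge → K)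
    (m : X.Point → K) (z : X.Point) :
    X.rep K (∑ p ∈ s, c p • pathElt K p.1 p.2) m z =
      ∑ p ∈ s, c p * X.rep K (pathElt K p.1 p.2) m z := by
  simp [map_sum, LinearMap.sum_apply, Finset.sum_apply]

/-- A nonzero combination of paths that end in `x` acts injectively on the functions supported over
`x`, and it does not lower their top degree. -/
theorem exists_rep_ne_zero {x : E.Vertex} {b : UnitalLeavitt K E} (hb : b ∈ pathSpan K x)
    (h0 : b ≠ 0) {m : X.Point → K} {t : X.Point} (ht : X.src t = x) (hm : m t ≠ 0)
    (hmax : ∀ z, X.src z = x → m z ≠ 0 → X.deg z ≤ X.deg t) :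
    ∃ z, X.rep K b m z ≠ 0 ∧ X.deg t ≤ X.deg z := by
  obtain ⟨c, hc, rfl⟩ := exists_sum_of_mem_pathSpan K hb
  have hne : c.support.Nonempty := by
    rw [Finset.nonempty_iff_ne_empty]
    intro h
    simp [h] at h0
  obtain ⟨p, hp, hpmax⟩ := c.support.exists_max_image (fun p => p.2.length) hne
  have hpt : IsPath p.1 p.2 (X.src t) := ht ▸ hc p hp
  refine ⟨X.encPath t p.2, ?_, by rw [deg_encPath]; omega⟩
  -- A longest path `p` moves `t` to a point that no other term reaches: a contribution of `p'`
  -- would start at a point of degree at most that of `t` and use a path no longer than `p`. Both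
  -- are then equalities, and `encPath_inj` gives `p' = p`.
  rw [rep_sum_smul, Finset.sum_eq_single p]
  · rw [X.rep_pathElt_encPath hpt]
    exact mul_ne_zero (Finsupp.mem_support_iff.1 hp) hm
  · intro p' hp' hpp'
    by_contra hne'
    obtain ⟨t', ht', heq, hm'⟩ := X.rep_pathElt_ne_zero (hc p' hp') (right_ne_zero_of_mul hne')
    have h1 := hmax t' ht' hm'
    have h2 := hpmax p' hp'
    have h3 := congrArg X.deg heq
    rw [deg_encPath, deg_encPath] at h3
    have hlen : p.2.length = p'.2.length := by omega
    exact hpp' (X.encPath_inj hpt (ht'.symm ▸ hc p' hp') hlen heq).1.symm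
  · exact fun h => absurd hp h

theorem le_deg_of_rep_ne_zero {x : E.Vertex} {b : UnitalLeavitt K E} (hb : b ∈ pathSpan K x)
    {m : X.Point → K} {N : ℤ} (hmin : ∀ z, X.src z = x → m z ≠ 0 → N ≤ X.deg z) {z : X.Point}
    (hz : X.rep K b m z ≠ 0) : N ≤ X.deg z := by
  obtain ⟨c, hc, rfl⟩ := exists_sum_of_mem_pathSpan K hb
  rw [rep_sum_smul] at hz
  obtain ⟨p, hp, hne⟩ := Finset.exists_ne_zero_of_sum_ne_zero hz
  obtain ⟨t, ht, rfl, hm⟩ := X.rep_pathElt_ne_zero (hc p hp) (right_ne_zero_of_mul hne)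
  have := hmin t ht hm
  rw [deg_encPath]
  omega

/-- A nontrivial path strictly raises the degree, so it moves the point mass off `t`. -/
theorem rep_single_eq_zero_of_mem_closedSpan [DecidableEq X.Point] {x : E.Vertex}
    {q : UnitalLeavitt K E} (hq : q ∈ closedSpan K x) (t : X.Point) :
    X.rep K q (Pi.single t 1) t = 0 := by
  induction hq using Submodule.span_induction with
  | mem b hb =>
    obtain ⟨l, ⟨hl, hne⟩, rfl⟩ := hb
    by_contra h
    obtain ⟨t', -, heq, hm⟩ := X.rep_pathElt_ne_zero hl h
    have ht : t' = t := by
      by_contra h'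
      exact hm (Pi.single_eq_of_ne h' _)
    have h2 := congrArg X.deg heq
    have h3 := List.length_pos_iff.2 hne
    rw [deg_encPath, ht] at h2
    omega
  | zero => simp
  | add a b _ _ ha hb => rw [map_add, LinearMap.add_apply, Pi.add_apply, ha, hb, add_zero]
  | smul k a _ ha => rw [map_smul, LinearMap.smul_apply, Pi.smul_apply, ha, smul_zero]

theorem vtx_add_ne_zero (X : GradedBranching E) {x : E.Vertex} {q : UnitalLeavitt K E}
    (hq : q ∈ closedSpan K x) : vtx K x + q ≠ 0 := by
  classical
  obtain ⟨t, ht⟩ := X.exists_src x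
  intro h
  have h1 := congrFun (LinearMap.congr_fun (congrArg (X.rep K) h) (Pi.single t 1)) t
  rw [map_add, LinearMap.add_apply, Pi.add_apply, X.rep_single_eq_zero_of_mem_closedSpan hq,
    rep_vtx, if_pos ht] at h1
  simp at h1

/-- With `m` the image under `d` of the point mass at `t`, the equation reads `m - l b m = δ_t`.
Comparing lowest and highest degrees of `m` over `x` gives a contradiction, because `l` strictly
raises degrees. -/
theorem one_sub_mul_ne_one (X : GradedBranching E) {x : E.Vertex} {l : List E.Edge}
    (hl : IsPath x l x) (hne : l ≠ [])
    {b : UnitalLeavitt K E} (hb : b ∈ pathSpan K x) (h0 : b ≠ 0) (hxb : vtx K x * b = b)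
    (d : UnitalLeavitt K E) : (1 - pathElt K x l * b) * d ≠ 1 := by
  classical
  intro hd
  obtain ⟨t, ht⟩ := X.exists_src x
  have hlen := List.length_pos_iff.2 hne
  set m : X.Point → K := X.rep K d (Pi.single t 1) with hm_def
  have hbdd : X.IsBdd K m := X.isBdd_rep d ⟨|X.deg t|, fun z hz => by
    have : z = t := by
      by_contra h
      exact hz (Pi.single_eq_of_ne h _)
    rw [this]⟩
  obtain ⟨N, hN⟩ := hbdd
  have heq : ∀ z, m z - X.rep K (pathElt K x l) (X.rep K b m) z =
      (Pi.single t 1 : X.Point → K) z := by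
    intro z
    have := congrFun (LinearMap.congr_fun (congrArg (X.rep K) hd) (Pi.single t 1)) z
    simpa [map_mul, map_sub, sub_mul] using this
  have hlow : ∀ n : ℤ, (∀ z, X.src z = x → m z ≠ 0 → n ≤ X.deg z) → ∀ z,
      X.rep K (pathElt K x l) (X.rep K b m) z ≠ 0 → n + 1 ≤ X.deg z := by
    intro n hn z hz
    obtain ⟨t', -, rfl, ht'⟩ := X.rep_pathElt_ne_zero hl hz
    have := X.le_deg_of_rep_ne_zero hb hn ht'
    rw [deg_encPath]
    omega
  have hS : ∃ n, ∃ z, X.src z = x ∧ m z ≠ 0 ∧ X.deg z = n := by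
    by_contra hS
    push Not at hS
    -- If `m` vanished over `x`, the hypothesis of `hlow` would be vacuous for every bound; the
    -- bound `X.deg t` forces `l b m` to vanish at `t`, whence `m t = 1`.
    have h1 := hlow (X.deg t) (fun z hz hmz => absurd rfl (hS _ z hz hmz)) t
    have h2 : X.rep K (pathElt K x l) (X.rep K b m) t = 0 := by
      by_contra h
      have := h1 h
      omega
    have h3 := heq t
    rw [h2, sub_zero, Pi.single_eq_same] at h3
    exact hS _ t ht (by simp [h3]) rfl
  obtain ⟨n₁, ⟨z₁, hz₁, hm₁, rfl⟩, hmin⟩ := Int.exists_least_of_bdd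
    ⟨-N, fun n ⟨z, _, hz, hzn⟩ => hzn ▸ (abs_le.1 (hN z hz)).1⟩ hS
  obtain ⟨n₂, ⟨z₂, hz₂, hm₂, rfl⟩, hmax⟩ := Int.exists_greatest_of_bdd
    ⟨N, fun n ⟨z, _, hz, hzn⟩ => hzn ▸ (abs_le.1 (hN z hz)).2⟩ hS
  -- At a point of least degree `l b m` vanishes by `hlow`, so `m` agrees there with the point mass.
  have h1 : z₁ = t := by
    by_contra h
    have h2 := heq z₁
    rw [Pi.single_eq_of_ne h, sub_eq_zero] at h2
    have := hlow _ (fun z hz hmz => hmin _ ⟨z, hz, hmz, rfl⟩) z₁ (h2 ▸ hm₁)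
    omega
  -- Here `b` does not lower the top degree and `l` raises it. So `l b m` is nonzero at a point over
  -- `x` above the top degree of `m`, where `m` vanishes; that point is not `t`, which has the least
  -- degree.
  obtain ⟨z, hz, hdeg⟩ := X.exists_rep_ne_zero hb h0 hz₂ hm₂
    fun z hz hmz => hmax _ ⟨z, hz, hmz, rfl⟩
  have hzx : X.src z = x := by
    rw [← hxb, map_mul, Module.End.mul_apply, rep_vtx, ite_ne_right_iff] at hz
    exact hz.1
  have h3 := heq (X.encPath z l)
  have hpath : IsPath x l (X.src z) := hzx.symm ▸ hl
  have hdeg' : X.deg z₂ < X.deg (X.encPath z l) := by rw [deg_encPath]; omega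
  have h4 : m (X.encPath z l) = 0 := by
    by_contra h
    have := hmax _ ⟨_, X.src_encPath hpath, h, rfl⟩
    omega
  have h5 : X.encPath z l ≠ t := by
    intro h
    rw [h, ← h1] at hdeg'
    have := hmin _ ⟨z₂, hz₂, hm₂, rfl⟩
    omega
  rw [X.rep_pathElt_encPath hpath, h4, Pi.single_eq_of_ne h5, zero_sub, neg_eq_zero] at h3
  exact hz h3

end GradedBranching

variable (K : Type w) [Field K] {E : DirectedGraph.{u, v}}

theorem closedSpan_le_pathSpan (x : E.Vertex) : closedSpan K x ≤ pathSpan K x := by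
  refine Submodule.span_mono ?_
  rintro _ ⟨l, hl, rfl⟩
  exact ⟨(x, l), hl.1, rfl⟩

theorem vtx_mem_pathSpan (x : E.Vertex) : vtx K x ∈ pathSpan K x :=
  Submodule.subset_span ⟨(x, []), rfl, rfl⟩

theorem vtx_mul_of_mem_closedSpan {x : E.Vertex} {q : UnitalLeavitt K E}
    (hq : q ∈ closedSpan K x) : vtx K x * q = q := by
  induction hq using Submodule.span_induction with
  | mem b hb => obtain ⟨p, hp, rfl⟩ := hb; exact vtx_mul_pathElt K hp.1
  | zero => exact mul_zero _
  | add a b _ _ ha hb => rw [mul_add, ha, hb]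
  | smul k a _ ha => rw [mul_smul_comm, ha]

theorem exists_one_sub_mul_ne_one {x : E.Vertex} {q : UnitalLeavitt K E}
    (hq : q ∈ closedSpan K x) :
    ∃ s ∈ LeavittPathAlgebra K E, ∀ d, (1 - s * (vtx K x + q)) * d ≠ 1 := by
  obtain ⟨X⟩ := E.nonempty_gradedBranching
  by_cases h : ∃ l, IsPath x l x ∧ l ≠ []
  · obtain ⟨l, hl, hne⟩ := h
    refine ⟨pathElt K x l, pathElt_mem K x l, X.one_sub_mul_ne_one hl hne
      (add_mem (vtx_mem_pathSpan K x) (closedSpan_le_pathSpan K x hq)) (X.vtx_add_ne_zero hq) ?_⟩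
    rw [mul_add, vtx_mul_self, vtx_mul_of_mem_closedSpan K hq]
  -- Without nontrivial closed paths the choice `s = x` suffices: left multiplication by `x`
  -- annihilates `1 - x`.
  · have hq0 : q = 0 := by
      have hempty : {l | IsPath x l x ∧ l ≠ []} = ∅ :=
        Set.eq_empty_iff_forall_notMem.2 fun l hl => h ⟨l, hl⟩
      rwa [closedSpan, hempty, Set.image_empty, Submodule.span_empty, Submodule.mem_bot] at hq
    refine ⟨vtx K x, leavittGen_mem K _, fun d hd => ?_⟩
    have h1 := congrArg (vtx K x * ·) hd
    simp only [hq0, add_zero, vtx_mul_self, mul_one] at h1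
    rw [← mul_assoc, mul_sub, mul_one, vtx_mul_self, sub_self, zero_mul] at h1
    exact X.vtx_add_ne_zero (zero_mem (closedSpan K x)) (by rw [← h1, add_zero])

/-- The edge `f` sends a point mass over its range to a point mass over its source, and
`exists_rep_ne_zero` shows that `b` does not annihilate the latter. -/
theorem mul_edg_ne_zero {f : E.Edge} {b : UnitalLeavitt K E}
    (hb : b ∈ pathSpan K (E.source f)) (h0 : b ≠ 0) : b * edg K f ≠ 0 := by
  classical
  obtain ⟨X⟩ := E.nonempty_gradedBranching
  obtain ⟨t, ht⟩ := X.exists_src (E.range f)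
  intro h
  obtain ⟨z, hz, -⟩ := X.exists_rep_ne_zero hb h0
    (m := X.rep K (edg K f) (Pi.single t 1)) (t := X.enc f t) (X.src_enc f t)
    (by rw [X.rep_gen, X.genOp_edge_enc K _ ht]; simp) (by
      intro z _ hz
      rw [X.rep_gen] at hz
      obtain ⟨t', -, rfl, ht'⟩ := X.genOp_edge_ne_zero K hz
      have : t' = t := by
        by_contra h'
        exact ht' (Pi.single_eq_of_ne h' _)
      rw [this])
  rw [← Module.End.mul_apply, ← map_mul, h] at hz
  simp at hz

end DirectedGraph

/-! ### Removing ghost edges, and local units -/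

namespace DirectedGraph

variable (K : Type w) [Field K] {E : DirectedGraph.{u, v}}

variable (E) in
/-- The span of the products of a path and at most `n` ghost edges. -/
noncomputable def ghostFiltration : ℕ → Submodule K (UnitalLeavitt K E)
  | 0 => ⨆ x, pathSpan K x
  | n + 1 => (⨆ x, pathSpan K x) ⊔
      Submodule.span K {a | ∃ c ∈ ghostFiltration n, ∃ e, a = c * gho K e}

theorem ghostFiltration_mono : Monotone (ghostFiltration K E) := by
  refine monotone_nat_of_le_succ fun n => ?_
  induction n with
  | zero => exact le_sup_left
  | succ n ih =>
    refine sup_le_sup_left (Submodule.span_mono ?_) _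
    rintro _ ⟨c, hc, e, rfl⟩
    exact ⟨c, ih hc, e, rfl⟩

theorem pathSpan_le_ghostFiltration (x : E.Vertex) (n : ℕ) :
    pathSpan K x ≤ ghostFiltration K E n :=
  (le_iSup (pathSpan K) x).trans (ghostFiltration_mono K (Nat.zero_le n))

theorem mul_gho_mem {n : ℕ} {b : UnitalLeavitt K E} (hb : b ∈ ghostFiltration K E n) (e : E.Edge) :
    b * gho K e ∈ ghostFiltration K E (n + 1) :=
  Submodule.mem_sup_right (Submodule.subset_span ⟨b, hb, e, rfl⟩)

theorem ghostFiltration_zero_le {N : Submodule K (UnitalLeavitt K E)}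
    (h : ∀ x, pathSpan K x ≤ N) : ghostFiltration K E 0 ≤ N :=
  iSup_le h

theorem ghostFiltration_succ_le {n : ℕ} {N : Submodule K (UnitalLeavitt K E)}
    (h : ∀ x, pathSpan K x ≤ N)
    (h' : ∀ c ∈ ghostFiltration K E n, ∀ e, c * gho K e ∈ N) :
    ghostFiltration K E (n + 1) ≤ N := by
  refine sup_le (iSup_le h) (Submodule.span_le.2 ?_)
  rintro _ ⟨c, hc, e, rfl⟩
  exact h' c hc e

theorem mul_vtx_mem_pathSpan {b : UnitalLeavitt K E} (hb : b ∈ ghostFiltration K E 0)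
    (x : E.Vertex) : b * vtx K x ∈ pathSpan K x := by
  refine ghostFiltration_zero_le K (N := (pathSpan K x).comap (LinearMap.mulRight K (vtx K x)))
    (fun y c hc => ?_) hb
  rw [Submodule.mem_comap, LinearMap.mulRight_apply, ← mul_vtx_of_mem_pathSpan K hc, mul_assoc]
  by_cases h : y = x
  · subst h
    rwa [vtx_mul_self, mul_vtx_of_mem_pathSpan K hc]
  · rw [vtx_mul_vtx_of_ne K h, mul_zero]
    exact zero_mem _

theorem mul_vtx_mem {n : ℕ} {b : UnitalLeavitt K E} (hb : b ∈ ghostFiltration K E n)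
    (x : E.Vertex) : b * vtx K x ∈ ghostFiltration K E n := by
  cases n with
  | zero => exact pathSpan_le_ghostFiltration K x 0 (mul_vtx_mem_pathSpan K hb x)
  | succ n =>
    refine ghostFiltration_succ_le K
      (N := (ghostFiltration K E (n + 1)).comap (LinearMap.mulRight K (vtx K x)))
      (fun y c hc => ?_) (fun c hc e => ?_) hb
    · rw [Submodule.mem_comap, LinearMap.mulRight_apply]
      exact pathSpan_le_ghostFiltration K x _
        (mul_vtx_mem_pathSpan K (pathSpan_le_ghostFiltration K y 0 hc) x)
    · rw [Submodule.mem_comap, LinearMap.mulRight_apply, mul_assoc]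
      by_cases h : E.source e = x
      · subst h
        rw [gho_mul_source]
        exact mul_gho_mem K hc e
      · rw [gho_mul_vtx_of_ne K h, mul_zero]
        exact zero_mem _

theorem mul_edg_mem_pathSpan {x : E.Vertex} {b : UnitalLeavitt K E} (hb : b ∈ pathSpan K x)
    (f : E.Edge) : b * edg K f ∈ pathSpan K (E.range f) := by
  refine (Submodule.span_le.2 ?_ :
    pathSpan K x ≤ (pathSpan K (E.range f)).comap (LinearMap.mulRight K (edg K f))) hb
  rintro _ ⟨⟨y, l⟩, hl, rfl⟩
  rw [SetLike.mem_coe, Submodule.mem_comap, LinearMap.mulRight_apply]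
  have hl : IsPath y l x := hl
  simp only
  by_cases h : x = E.source f
  · subst h
    rw [pathElt_mul_edg K hl]
    exact Submodule.subset_span ⟨(y, l ++ [f]), isPath_append_singleton hl, rfl⟩
  · rw [← pathElt_mul_vtx K hl, mul_assoc, vtx_mul_edg_of_ne K h, mul_zero]
    exact zero_mem _

/-- By (CK-1) the edge `f` cancels the last ghost edge or annihilates the term; this drives the
induction in `exists_mul_mem_pathSpan`. -/
theorem mul_edg_mem_of_succ {n : ℕ} {b : UnitalLeavitt K E}
    (hb : b ∈ ghostFiltration K E (n + 1)) (f : E.Edge) :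
    b * edg K f ∈ ghostFiltration K E n := by
  refine ghostFiltration_succ_le K
    (N := (ghostFiltration K E n).comap (LinearMap.mulRight K (edg K f)))
    (fun y c hc => ?_) (fun c hc e => ?_) hb
  · exact pathSpan_le_ghostFiltration K _ _ (mul_edg_mem_pathSpan K hc f)
  · rw [Submodule.mem_comap, LinearMap.mulRight_apply, mul_assoc]
    by_cases h : e = f
    · subst h
      rw [gho_mul_edg_self]
      exact mul_vtx_mem K hc _
    · rw [gho_mul_edg_of_ne K h, mul_zero]
      exact zero_mem _

theorem exists_mem_ghostFiltration {a : UnitalLeavitt K E} (ha : a ∈ LeavittPathAlgebra K E) :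
    ∃ n, a ∈ ghostFiltration K E n := by
  -- Membership alone does not pass to products; the induction also carries that right
  -- multiplication by `a` preserves the union of the filtration.
  suffices h : (∃ n, a ∈ ghostFiltration K E n) ∧
      ∀ n, ∀ b ∈ ghostFiltration K E n, ∃ n, b * a ∈ ghostFiltration K E n from h.1
  induction ha using NonUnitalAlgebra.adjoin_induction with
  | mem a ha =>
    obtain ⟨g, rfl⟩ := ha
    have hg : ∀ n, ∀ b ∈ ghostFiltration K E n,
        ∃ n, b * leavittGen K E g ∈ ghostFiltration K E n := by
      intro n b hb
      cases g with
      | vertex x => exact ⟨n, mul_vtx_mem K hb x⟩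
      | edge e => exact ⟨n, mul_edg_mem_of_succ K (ghostFiltration_mono K n.le_succ hb) e⟩
      | ghost e => exact ⟨n + 1, mul_gho_mem K hb e⟩
    refine ⟨?_, hg⟩
    have hv := fun x => pathSpan_le_ghostFiltration K x 0 (vtx_mem_pathSpan K (E := E) x)
    cases g with
    | vertex x => exact ⟨0, hv x⟩
    | edge e => have h := hg 0 _ (hv (E.source e)); rwa [source_mul_edg] at h
    | ghost e => have h := hg 0 _ (hv (E.range e)); rwa [range_mul_gho] at h
  | add a b _ _ ha hb =>
    obtain ⟨⟨n, hn⟩, ha⟩ := ha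
    obtain ⟨⟨n', hn'⟩, hb⟩ := hb
    have hadd : ∀ {a b : UnitalLeavitt K E} {n n' : ℕ}, a ∈ ghostFiltration K E n →
        b ∈ ghostFiltration K E n' → ∃ n, a + b ∈ ghostFiltration K E n :=
      fun {a b n n'} h h' => ⟨max n n', add_mem (ghostFiltration_mono K (le_max_left n n') h)
        (ghostFiltration_mono K (le_max_right n n') h')⟩
    refine ⟨hadd hn hn', fun k c hc => ?_⟩
    obtain ⟨i, hi⟩ := ha k c hc
    obtain ⟨j, hj⟩ := hb k c hc
    rw [mul_add]
    exact hadd hi hj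
  | zero => exact ⟨⟨0, zero_mem _⟩, fun n b _ => ⟨0, by rw [mul_zero]; exact zero_mem _⟩⟩
  | mul a b _ _ ha hb =>
    obtain ⟨⟨n, hn⟩, ha⟩ := ha
    refine ⟨hb.2 n a hn, fun k c hc => ?_⟩
    obtain ⟨i, hi⟩ := ha k c hc
    rw [← mul_assoc]
    exact hb.2 i _ hi
  | smul k a _ ha =>
    obtain ⟨⟨n, hn⟩, ha⟩ := ha
    refine ⟨⟨n, Submodule.smul_mem _ k hn⟩, fun i c hc => ?_⟩
    obtain ⟨j, hj⟩ := ha i c hc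
    exact ⟨j, by rw [mul_smul_comm]; exact Submodule.smul_mem _ k hj⟩

/-- Right local units: finite sums of vertices. Allowing every larger `T` makes the claim stable
under addition. -/
theorem exists_mul_sum_vtx_eq {n : ℕ} {b : UnitalLeavitt K E} (hb : b ∈ ghostFiltration K E n) :
    ∃ S : Finset E.Vertex, ∀ T, S ⊆ T → b * ∑ x ∈ T, vtx K x = b := by
  classical
  have hle : ghostFiltration K E n ≤ Submodule.span K {a | ∃ x, a * vtx K x = a} := by
    have hpath : ∀ x : E.Vertex, pathSpan K x ≤ Submodule.span K {a | ∃ x, a * vtx K x = a} :=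
      fun x a ha => Submodule.subset_span ⟨x, mul_vtx_of_mem_pathSpan K ha⟩
    cases n with
    | zero => exact ghostFiltration_zero_le K hpath
    | succ n =>
      refine ghostFiltration_succ_le K hpath fun c _ e => Submodule.subset_span ⟨E.source e, ?_⟩
      rw [mul_assoc, gho_mul_source]
  have hb' := hle hb
  clear hb
  induction hb' using Submodule.span_induction with
  | mem a ha =>
    obtain ⟨x, hx⟩ := ha
    refine ⟨{x}, fun T hT => ?_⟩
    rw [← hx, mul_assoc, Finset.mul_sum, Finset.sum_eq_single x, vtx_mul_self]
    · exact fun y _ hy => vtx_mul_vtx_of_ne K hy.symm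
    · exact fun h => absurd (hT (Finset.mem_singleton_self x)) h
  | zero => exact ⟨∅, fun T _ => zero_mul _⟩
  | add a c _ _ ha hc =>
    obtain ⟨S, hS⟩ := ha
    obtain ⟨S', hS'⟩ := hc
    refine ⟨S ∪ S', fun T hT => ?_⟩
    rw [add_mul, hS T (Finset.union_subset_left hT), hS' T (Finset.union_subset_right hT)]
  | smul k a _ ha =>
    obtain ⟨S, hS⟩ := ha
    exact ⟨S, fun T hT => by rw [smul_mul_assoc, hS T hT]⟩

theorem exists_mul_vtx_ne_zero {n : ℕ} {b : UnitalLeavitt K E}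
    (hb : b ∈ ghostFiltration K E n) (h0 : b ≠ 0) : ∃ x, b * vtx K x ≠ 0 := by
  by_contra! h
  obtain ⟨S, hS⟩ := exists_mul_sum_vtx_eq K hb
  rw [← hS S subset_rfl, Finset.mul_sum, Finset.sum_eq_zero fun x _ => h x] at h0
  exact h0 rfl

theorem exists_eq_add_sum_mul_gho {n : ℕ} {b : UnitalLeavitt K E}
    (hb : b ∈ ghostFiltration K E (n + 1)) :
    ∃ a ∈ ghostFiltration K E 0, ∃ c : E.Edge →₀ UnitalLeavitt K E,
      b = a + ∑ e ∈ c.support, c e * gho K e := by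
  have hle : ghostFiltration K E (n + 1) ≤ ghostFiltration K E 0 ⊔
      LinearMap.range (Finsupp.lsum K fun e : E.Edge => LinearMap.mulRight K (gho K e)) := by
    refine ghostFiltration_succ_le K
      (fun x => (pathSpan_le_ghostFiltration K x 0).trans le_sup_left) fun c _ e =>
        Submodule.mem_sup_right ⟨Finsupp.single e c, by simp⟩
  obtain ⟨a, ha, _, ⟨c, rfl⟩, h⟩ := Submodule.mem_sup.1 (hle hb)
  exact ⟨a, ha, c, h.symm⟩

/-- An element that is annihilated by all edges on the right is a combination of paths at every
vertex where it does not vanish. -/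
theorem mul_vtx_mem_pathSpan_of_mul_edg {n : ℕ} {b : UnitalLeavitt K E}
    (hb : b ∈ ghostFiltration K E (n + 1)) (hedg : ∀ e, b * edg K e = 0) {x : E.Vertex}
    (hx : b * vtx K x ≠ 0) : b * vtx K x ∈ pathSpan K x := by
  classical
  obtain ⟨a, ha, c, rfl⟩ := exists_eq_add_sum_mul_gho K hb
  -- Multiplying `b` by `e` isolates the coefficient of the ghost edge of `e`. Thus `b` is
  -- determined by its ghost-free part `a`, and `b x = a (x - ∑ e e*)` over the edges of the support
  -- leaving `x`.
  have hc : ∀ e, c e * vtx K (E.range e) = -(a * edg K e) := by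
    intro e
    have h := hedg e
    rw [add_mul, Finset.sum_mul, Finset.sum_eq_single e] at h
    · rw [mul_assoc, gho_mul_edg_self] at h
      exact eq_neg_of_add_eq_zero_right h
    · intro f _ hf
      rw [mul_assoc, gho_mul_edg_of_ne K hf, mul_zero]
    · intro he
      rw [Finsupp.notMem_support_iff.1 he, zero_mul, zero_mul]
  have hbx : (a + ∑ e ∈ c.support, c e * gho K e) * vtx K x =
      a * (vtx K x - ∑ e ∈ c.support with E.source e = x, edg K e * gho K e) := by
    rw [add_mul, mul_sub, sub_eq_add_neg, Finset.sum_mul, Finset.sum_filter, Finset.mul_sum,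
      ← Finset.sum_neg_distrib]
    congr 1
    refine Finset.sum_congr rfl fun e _ => ?_
    split_ifs with h
    · rw [← h, mul_assoc, gho_mul_source, ← range_mul_gho, ← mul_assoc, hc, range_mul_gho, ← mul_assoc]
      exact neg_mul (a * edg K e) (gho K e)
    · rw [mul_assoc, gho_mul_vtx_of_ne K h, mul_zero, mul_zero, neg_zero]
  have hax := mul_vtx_mem_pathSpan K ha x
  rw [hbx] at hx ⊢
  -- An edge `f` leaving `x` outside the support gives `a f = 0`, hence `a x = 0` and `b x = 0`.
  -- Otherwise `x` emits finitely many edges: if there are any, (CK-2) makes `b x` vanish, and if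
  -- `x` is a sink, then `b x = a x`.
  by_cases hsub : ∃ f, E.source f = x ∧ f ∉ c.support
  · obtain ⟨f, rfl, hf⟩ := hsub
    have haf : a * edg K f = 0 := by
      rw [← neg_eq_zero, ← hc, Finsupp.notMem_support_iff.1 hf, zero_mul]
    have ha0 : a * vtx K (E.source f) = 0 := by
      by_contra h
      refine mul_edg_ne_zero K hax h ?_
      rw [mul_assoc, source_mul_edg, haf]
    refine absurd ?_ hx
    rw [mul_sub, ha0, zero_sub, neg_eq_zero, Finset.mul_sum]
    refine Finset.sum_eq_zero fun e he => ?_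
    rw [← source_mul_edg, (Finset.mem_filter.1 he).2, mul_assoc, ← mul_assoc a, ha0, zero_mul]
  · push Not at hsub
    have hfin : (E.emitted x).Finite := c.support.finite_toSet.subset fun f hf => hsub f hf
    have hfilter : (c.support.filter fun e => E.source e = x) = hfin.toFinset := by
      ext e
      simp only [Finset.mem_filter, Set.Finite.mem_toFinset]
      exact ⟨fun h => h.2, fun h => ⟨hsub e h, h⟩⟩
    rw [hfilter] at hx ⊢
    by_cases hne : (E.emitted x).Nonempty
    · rw [← vtx_eq_sum K x hne hfin, sub_self, mul_zero] at hx
      exact absurd rfl hx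
    · have hempty : hfin.toFinset = ∅ := by
        rw [Set.Finite.toFinset_eq_empty]
        exact Set.not_nonempty_iff_eq_empty.1 hne
      rwa [hempty, Finset.sum_empty, sub_zero]

theorem exists_mul_mem_pathSpan {n : ℕ} {b : UnitalLeavitt K E}
    (hb : b ∈ ghostFiltration K E n) (h0 : b ≠ 0) :
    ∃ t ∈ LeavittPathAlgebra K E, ∃ x, b * t ∈ pathSpan K x ∧ b * t ≠ 0 := by
  induction n generalizing b with
  | zero =>
    obtain ⟨x, hx⟩ := exists_mul_vtx_ne_zero K hb h0
    exact ⟨vtx K x, leavittGen_mem K _, x, mul_vtx_mem_pathSpan K hb x, hx⟩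
  | succ n ih =>
    by_cases hedg : ∀ e, b * edg K e = 0
    · obtain ⟨x, hx⟩ := exists_mul_vtx_ne_zero K hb h0
      exact ⟨vtx K x, leavittGen_mem K _, x, mul_vtx_mem_pathSpan_of_mul_edg K hb hedg hx, hx⟩
    · push Not at hedg
      obtain ⟨e, he⟩ := hedg
      obtain ⟨t, ht, x, hx, hne⟩ := ih (mul_edg_mem_of_succ K hb e) he
      rw [mul_assoc] at hx hne
      exact ⟨edg K e * t, mul_mem (leavittGen_mem K _) ht, x, hx, hne⟩

/-- The ideal generated by a nonzero element of a Leavitt path algebra is not quasi-regular. -/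
theorem exists_one_sub_mul_mul_ne_one {b : UnitalLeavitt K E} (hb : b ∈ LeavittPathAlgebra K E)
    (h0 : b ≠ 0) : ∃ s ∈ LeavittPathAlgebra K E, ∃ t ∈ LeavittPathAlgebra K E,
      ∀ d, (1 - s * b * t) * d ≠ 1 := by
  obtain ⟨n, hn⟩ := exists_mem_ghostFiltration K hb
  obtain ⟨t, ht, x, hx, hne⟩ := exists_mul_mem_pathSpan K hn h0
  obtain ⟨s, hs, q, hq, hsq⟩ := exists_mul_eq_add_of_mem_pathSpan K hx hne
  obtain ⟨r, hr, hd⟩ := exists_one_sub_mul_ne_one K hq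
  refine ⟨r * s, mul_mem hr hs, t, ht, ?_⟩
  rwa [mul_assoc, mul_assoc, hsq]

end DirectedGraph

/-! ### Quasi-regularity in the endomorphism ring -/

/-- Left multiplication by an element, as an endomorphism of the right module. -/
def rightModuleEnd.mulLeft {R : Type u} [NonUnitalRing R] (a : R) : rightModuleEnd R :=
  ⟨AddMonoidHom.mulLeft a, fun x y => (mul_assoc a x y).symm⟩

namespace rightModuleEnd

variable {R : Type u} [NonUnitalRing R]

/-- Left multiplications form a left ideal, which is why quasi-inverses of left multiplications
again come from elements of the algebra. -/
theorem mul_mulLeft (f : rightModuleEnd R) (a : R) : f * mulLeft a = mulLeft (f.1 a) :=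
  Subtype.ext (AddMonoidHom.ext fun x => f.2 a x)

theorem mulLeft_mul (a b : R) : mulLeft (a * b) = mulLeft a * mulLeft b :=
  Subtype.ext (AddMonoidHom.ext fun x => mul_assoc a b x)

end rightModuleEnd

/-- The hypothesis is `(1 - z)(1 + y) w = w`, expanded so that no identity element is needed. -/
theorem Ring.sub_sub_mul_mul_eq_zero {R : Type u} [NonUnitalRing R] {y z w : R}
    (h : w + y * w - z * (w + y * w) = w) :
    (y - z - z * y) * w = 0 := by
  rw [sub_mul, sub_mul, ← sub_eq_zero.2 h, mul_add, mul_assoc]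
  abel

theorem Ring.one_sub_mul_one_add_eq_one_of_sub {A : Type u} [Ring A] {y z : A}
    (h : y - z - z * y = 0) : (1 - z) * (1 + y) = 1 := by
  rw [← sub_eq_zero, ← h]
  noncomm_ring

theorem Ring.exists_mul_one_sub_eq_one {A : Type u} [Ring A] {x : A} (hx : x ∈ Ring.jacobson A) :
    ∃ y, y * (1 - x) = 1 := by
  rw [← Ideal.jacobson_bot] at hx
  obtain ⟨z, hz⟩ := Ideal.mem_jacobson_iff.1 hx (-1)
  refine ⟨z, ?_⟩
  rw [Ideal.mem_bot, sub_eq_zero] at hz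
  calc z * (1 - x) = z * -1 * x + z := by noncomm_ring
    _ = 1 := hz

/-- An element of the radical is right quasi-regular. -/
theorem Ring.exists_one_sub_mul_one_add_eq_one {A : Type u} [Ring A] {x : A}
    (hx : x ∈ Ring.jacobson A) : ∃ y, (1 - x) * (1 + y * x) = 1 := by
  obtain ⟨y, hy⟩ := Ring.exists_mul_one_sub_eq_one hx
  have hy' : y = 1 + y * x := by rw [← hy]; noncomm_ring
  -- Since `y = 1 + y x` with `y x` in the radical, `y` also has a left inverse, which must equal
  -- its right inverse `1 - x`.
  obtain ⟨z, hz⟩ := Ring.exists_mul_one_sub_eq_one (neg_mem ((Ring.jacobson A).mul_mem_left y hx))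
  rw [sub_neg_eq_add, ← hy'] at hz
  refine ⟨y, ?_⟩
  rw [← hy', ← left_inv_eq_right_inv hz hy, hz]


theorem mainTheorem7 (K : Type w) [Field K] (E : DirectedGraph.{u, v}) :
    Ring.jacobson (rightModuleEnd (LeavittPathAlgebra K E)) = ⊥ := by
  rw [eq_bot_iff]
  intro f hf
  rw [Ideal.mem_bot]
  by_contra hne
  have ha : ∃ a, f.1 a ≠ 0 := by
    by_contra! h
    exact hne (Subtype.ext (AddMonoidHom.ext h))
  obtain ⟨a, ha⟩ := ha
  obtain ⟨s, hs, t, ht, h⟩ := DirectedGraph.exists_one_sub_mul_mul_ne_one K (f.1 a).2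
    fun h0 => ha (Subtype.ext h0)
  lift s to LeavittPathAlgebra K E using hs
  lift t to LeavittPathAlgebra K E using ht
  set z : LeavittPathAlgebra K E := s * f.1 a * t with hz_def
  have hz : rightModuleEnd.mulLeft z ∈ Ring.jacobson (rightModuleEnd (LeavittPathAlgebra K E)) := by
    rw [hz_def, rightModuleEnd.mulLeft_mul, rightModuleEnd.mulLeft_mul,
      ← rightModuleEnd.mul_mulLeft]
    exact Ideal.mul_mem_right _ _ (Ideal.mul_mem_left _ _ (Ideal.mul_mem_right _ _ hf))
  obtain ⟨g, hg⟩ := Ring.exists_one_sub_mul_one_add_eq_one hz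
  rw [rightModuleEnd.mul_mulLeft] at hg
  set y := g.1 z
  -- The identity `hg` holds only between operators; evaluating it at a local unit `u` of `y - z - z
  -- * y` turns it into an identity of elements.
  have hzero : y - z - z * y = 0 := by
    obtain ⟨n, hn⟩ := DirectedGraph.exists_mem_ghostFiltration K (y - z - z * y).2
    obtain ⟨S, hS⟩ := DirectedGraph.exists_mul_sum_vtx_eq K hn
    have hmem : ∑ x ∈ S, DirectedGraph.vtx K x ∈ LeavittPathAlgebra K E :=
      sum_mem fun x _ => DirectedGraph.leavittGen_mem K _
    set u : LeavittPathAlgebra K E := ⟨_, hmem⟩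
    have hu : (y - z - z * y) * u = y - z - z * y := Subtype.ext (hS S subset_rfl)
    have h1 : u + y * u - z * (u + y * u) = u := DFunLike.congr_fun (congrArg Subtype.val hg) u
    rw [← hu]
    exact Ring.sub_sub_mul_mul_eq_zero (R := LeavittPathAlgebra K E) h1
  refine h (1 + y) ?_
  have h2 : (y : DirectedGraph.UnitalLeavitt K E) - z - z * y = 0 := congrArg Subtype.val hzero
  exact Ring.one_sub_mul_one_add_eq_one_of_sub h2
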